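/- **Definitions.** A *multiplicity sequence* is a nonincreasing sequence $M=(m_k)_{k\ge1}$ of positive integers, eventually equal to $1$, such that for every $k$ there is an integer $s_k\ge k+1$ (necessarily unique) with $m_k=\sum_{l=k+1}^{s_k}m_l$. For multiplicity sequences $M\ne M'$, with associated integers $s_k,s'_k$, put $\mathrm{Comp}(M,M')=\min\{\min(s_k,s'_k): s_k\neq s'_k\}$; put $\mathrm{Comp}(M,M)=+\infty$. A submonoid $S\subseteq\mathbb N^r$ is a *good semigroup* if (i) $\min(a,b)\in S$ (componentwise) for all $a,b\in S$; (ii) if $a,b\in S$ and $a[i]=b[i]$, there is $c\in S$ with $c[i]>a[i]$, $c[j]\ge\min(a[j],b[j])$ for all $j\ne i$, with equality if $a[j]\ne b[j]$; (iii) $\delta+\mathbb N^r\subseteq S$ for some $\delta\in S$. It is *local* if $0$ is its only element with a zero component, and *Arf* if for every $\alpha\in S$ the set $\{\beta-\alpha:\beta\in S,\ \beta\ge\alpha\}$ is closed under addition. If $\delta$ is the conductor of $S$ (the least vector with $\delta+\mathbb N^r\subseteq S$), the *genus* of $S$ is $d_1-d_2$, where $d_1$ (resp. $d_2$) is the length of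 a saturated chain from $0$ to $\delta$ in $\mathbb N^r$ (resp. in $S$). An *untwisted tree* $T_E=(p_1,\dots,p_{r-1})$ consists of an ordered collection $E=\{M_1,\dots,M_r\}$ of multiplicity sequences and integers $p_i\ge1$. Branches $i<h$ are glued at level $j\geq 1$ iff $j\le\min(p_i,\dots,p_{h-1})$ (and each branch is glued to itself). The node at level $j$ on branch $i$ is the vector whose $h$-th component is $M_h[j]$ if the branches $i$ and $h$ are glued at level $j$, and $0$ otherwise; it is shared by all branches glued to $i$ at level $j$. The tree is the *multiplicity tree* of $S$ if $S=\{0\}\cup\{\sum_{\mathbf n\in T'}\mathbf n\}$, where $T'$ runs over the finite subtrees of $T_E$ containing its root. For $n\in\mathbb Z$ let $\mathrm{Gen}(r,n)$ be the set of all untwisted trees with $r$ branches that are the multiplicity tree of some local Arf good semigroup of $\mathbb N^r$ of genus $n$. For $1\le t<r$, $p\ge1$ and $k\in\mathbb Z$, let $I_r^n(t,p,k)$ be the set of all untwisted trees $T_E=(p_1,\dots,p_{r-1})$ with $E=\{M_1,\dots,M_r\}$ such that the tree $(p_1,\dots,p_{t-1})$ on $\{M_1,\dots,M_t\}$ is in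 $\mathrm{Gen}(t,k)$, the tree $(p_{t+1},\dots,p_{r-1})$ on $\{M_{t+1},\dots,M_r\}$ is in $\mathrm{Gen}(r-t,n-p-k)$, and $p_t=p\le\mathrm{Comp}(M_t,M_{t+1})$. The inverse of $T_E=(p_1,\dots,p_{r-1})$ is the tree $(p_{r-1},\dots,p_1)$ on $\{M_r,\dots,M_1\}$, and $U^{-1}=\{T^{-1}:T\in U\}$ for a set $U$ of trees. **Proposition.** Let $r,n,t\in\mathbb N$ with $1\le t\le r/2$, and let $\lambda(p)$ be integers with $\lambda(p)\ge\frac{n-p-1}{2}$ for every integer $p$ with $1\le p\le n-r+2$. Then $$\mathrm{Gen}(r,n)=\bigcup_{p=1}^{n-r+2}\ \bigcup_{k=t-1}^{\lambda(p)}\Bigl(I_r^n(t,p,k)\cup\bigl(I_r^n(t,p,k)\bigr)^{-1}\Bigr).$$ -/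

import Mathlib

/-- A multiplicity sequence `m₁ ≥ m₂ ≥ ⋯` of positive integers. The entry `m_{j+1}` is `seq j`.
With this shift, `∑_{l=k+1}^{s} m_l` is the sum of `seq` over `Finset.Ico k s`. -/
@[ext]
structure MultSeq where
  seq : ℕ → ℕ
  pos : ∀ j, 0 < seq j
  anti : Antitone seq
  eventually_one : ∃ K, ∀ j, K ≤ j → seq j = 1
  sum_eq : ∀ j, ∃ s, j + 2 ≤ s ∧ seq j = ∑ l ∈ Finset.Ico (j + 1) s, seq l

/-- The integer `s_k` with `m_k = ∑_{l=k+1}^{s_k} m_l`, for `k = j + 1`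
(it is unique, as the entries are positive). -/
def MultSeq.sumEnd (M : MultSeq) (j : ℕ) : ℕ := Nat.find (M.sum_eq j)

open Classical in
/-- The compatibility `Comp(M₁, M₂)`: the minimum of `min (s_{1,k}, s_{2,k})` over the `k` with
`s_{1,k} ≠ s_{2,k}`, and `+∞` if `M₁ = M₂`. -/
noncomputable def Comp (M₁ M₂ : MultSeq) : ℕ∞ :=
  if M₁ = M₂ then ⊤
  else ⨅ (j : ℕ) (_ : M₁.sumEnd j ≠ M₂.sumEnd j),
    ((min (M₁.sumEnd j) (M₂.sumEnd j) : ℕ) : ℕ∞)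

/-- A good semigroup of `ℕ^r`. -/
structure IsGoodSemigroup {r : ℕ} (S : AddSubmonoid (Fin r → ℕ)) : Prop where
  inf_mem : ∀ a ∈ S, ∀ b ∈ S, a ⊓ b ∈ S
  exists_gt : ∀ a ∈ S, ∀ b ∈ S, ∀ i, a i = b i →
    ∃ c ∈ S, a i < c i ∧
      (∀ j, j ≠ i → min (a j) (b j) ≤ c j) ∧
      (∀ j, j ≠ i → a j ≠ b j → c j = min (a j) (b j))
  exists_cone : ∃ δ ∈ S, ∀ x, δ ≤ x → x ∈ S

/-- The zero vector is the only element with a zero component. -/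
def IsLocalSemigroup {r : ℕ} (S : AddSubmonoid (Fin r → ℕ)) : Prop :=
  ∀ a ∈ S, (∃ i, a i = 0) → a = 0

/-- For every `α ∈ S`, the set `S(α) - α`, where `S(α) = {β ∈ S | β ≥ α}`, is closed under
addition. -/
def IsArfSemigroup {r : ℕ} (S : AddSubmonoid (Fin r → ℕ)) : Prop :=
  ∀ α ∈ S, ∀ x y : Fin r → ℕ, α + x ∈ S → α + y ∈ S → α + (x + y) ∈ S

/-- `δ` is the conductor of `S`: the least vector with `δ + ℕ^r ⊆ S`. -/
def IsConductor {r : ℕ} (S : AddSubmonoid (Fin r → ℕ)) (δ : Fin r → ℕ) : Prop :=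
  IsLeast {c : Fin r → ℕ | ∀ x, c ≤ x → x ∈ S} δ

/-- There is a saturated chain `a = α₀ < α₁ < ⋯ < α_n = b` of length `n` in `S`
(no element of `S` lies strictly between two consecutive terms). -/
def HasSaturatedChain {r : ℕ} (S : Set (Fin r → ℕ)) (a b : Fin r → ℕ) (n : ℕ) : Prop :=
  ∃ α : Fin (n + 1) → Fin r → ℕ, (∀ i, α i ∈ S) ∧ α 0 = a ∧ α (Fin.last n) = b ∧
    ∀ i : Fin n, α i.castSucc < α i.succ ∧ ∀ s ∈ S, ¬ (α i.castSucc < s ∧ s < α i.succ)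

/-- `S` has genus `g = d(ℕ^r ∖ C) - d(S ∖ C)`, where `C = δ + ℕ^r`, `δ` is the conductor of `S`, and
`d(E ∖ C)` is the length of a saturated chain in `E` from `0` to `δ`. -/
def HasGenus {r : ℕ} (S : AddSubmonoid (Fin r → ℕ)) (g : ℤ) : Prop :=
  ∃ δ, IsConductor S δ ∧ ∃ d₁ d₂ : ℕ,
    HasSaturatedChain Set.univ 0 δ d₁ ∧ HasSaturatedChain (S : Set (Fin r → ℕ)) 0 δ d₂ ∧
    g = (d₁ : ℤ) - d₂

/-- An untwisted tree `T_E = (p₁, …, p_{r-1})` with `r` branches, where `E = {M₁, …, M_r}` is an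
ordered collection of multiplicity sequences (those along the branches) and `p_i ≥ 1` is the highest
level at which the branches `i` and `i + 1` are glued. Here `M_{i+1} = E i`, `p_{i+1} = p i`. -/
@[ext]
structure UntwistedTree (r : ℕ) where
  E : Fin r → MultSeq
  p : Fin (r - 1) → ℕ
  p_pos : ∀ i, 1 ≤ p i

namespace UntwistedTree

variable {r : ℕ}

/-- The branches `i` and `h` are glued at level `j + 1`: all the consecutive branches between them
are glued at that level. -/
def Glued (T : UntwistedTree r) (i h : Fin r) (j : ℕ) : Prop :=
  ∀ m : Fin (r - 1), min (i : ℕ) (h : ℕ) ≤ (m : ℕ) → (m : ℕ) < max (i : ℕ) (h : ℕ) →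
    j + 1 ≤ T.p m

open Classical in
/-- The node, a vector of `ℕ^r`, on the branch `i` at level `j + 1`: its `h`-th coordinate is the
entry of `M_h` at that level if the branch `h` passes through the node, and `0` otherwise. -/
noncomputable def node (T : UntwistedTree r) (i : Fin r) (j : ℕ) : Fin r → ℕ :=
  fun h => if T.Glued i h j then (T.E h).seq j else 0

/-- A finite subtree of `T` rooted in the root of `T`, as a finite set of nodes that contains the
root and, with a node, its parent. A node is recorded together with its level: nodes on one level
are told apart by their supports, nodes on different levels may be equal as vectors. -/
structure IsRootedSubtree (T : UntwistedTree r) (V : Finset (ℕ × (Fin r → ℕ))) : Prop where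
  subset : ∀ v ∈ V, ∃ i j, v = (j, T.node i j)
  root_mem : ∀ i, (0, T.node i 0) ∈ V
  parent_mem : ∀ i j, (j + 1, T.node i (j + 1)) ∈ V → (j, T.node i j) ∈ V

/-- `T` is the multiplicity tree of `S`: the nonzero elements of `S` are the sums of the nodes of the
finite subtrees of `T` rooted in the root of `T`. -/
def IsMultiplicityTreeOf (T : UntwistedTree r) (S : AddSubmonoid (Fin r → ℕ)) : Prop :=
  (S : Set (Fin r → ℕ)) = {0} ∪ {x | ∃ V, T.IsRootedSubtree V ∧ x = ∑ v ∈ V, v.2}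

/-- The tree `T_{E_t} = (p₁, …, p_{t-1})` with `E_t = {M₁, …, M_t}`. -/
def take (T : UntwistedTree r) (t : ℕ) (h : t ≤ r) : UntwistedTree t where
  E i := T.E ⟨i, by omega⟩
  p i := T.p ⟨i, by omega⟩
  p_pos _ := T.p_pos _

/-- The tree `T_{E^t} = (p_{t+1}, …, p_{r-1})` with `E^t = {M_{t+1}, …, M_r}`. -/
def drop (T : UntwistedTree r) (t : ℕ) : UntwistedTree (r - t) where
  E i := T.E ⟨t + i, by omega⟩
  p i := T.p ⟨t + i, by omega⟩
  p_pos _ := T.p_pos _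

/-- The tree `T⁻¹ = (p_{r-1}, …, p₁)` with `E⁻¹ = {M_r, …, M₁}`. -/
def reverse (T : UntwistedTree r) : UntwistedTree r where
  E i := T.E i.rev
  p i := T.p i.rev
  p_pos _ := T.p_pos _

end UntwistedTree

/-- `Gen(r, n)`: the untwisted multiplicity trees of the local Arf good semigroups of `ℕ^r` of
genus `n`. The second argument is an integer, so that differences of indices do not truncate. -/
def Gen (r : ℕ) (n : ℤ) : Set (UntwistedTree r) :=
  {T | ∃ S : AddSubmonoid (Fin r → ℕ), IsGoodSemigroup S ∧ IsLocalSemigroup S ∧ IsArfSemigroup S ∧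
    T.IsMultiplicityTreeOf S ∧ HasGenus S n}

/-- `I_r^n(t, p, k)`: the trees `T_E = (p₁, …, p_{r-1})` with `T_{E_t} ∈ Gen(t, k)`,
`T_{E^t} ∈ Gen(r - t, n - p - k)` and `p_t = p ≤ Comp(M_t, M_{t+1})`. -/
def ISet (r : ℕ) (n : ℤ) (t p : ℕ) (k : ℤ) (ht : 1 ≤ t) (htr : t < r) : Set (UntwistedTree r) :=
  {T | T.take t htr.le ∈ Gen t k ∧ T.drop t ∈ Gen (r - t) (n - p - k) ∧
    T.p ⟨t - 1, by omega⟩ = p ∧ (p : ℕ∞) ≤ Comp (T.E ⟨t - 1, by omega⟩) (T.E ⟨t, htr⟩)}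

/-! Record a finite rooted subtree of `T_E` by its depth `d_i` along each branch `i`. The depth
vectors of subtrees are those with `min (d_i, p_i) = min (d_{i+1}, p_i)`, and the sum of the nodes
is the vector of partial sums `∑_{l ≤ d_i} M_i[l]`. Hence the semigroup with multiplicity tree
`T_E`, if there is one, is always good and local. It is Arf exactly when
`p_i ≤ Comp (M_i, M_{i+1})` for all `i`: if `α` and `β` have the constant depths `k - 1` and `k`,
then `2 β - α` has depth `s_k` along each branch, and every `β + γ - α` is reached from such steps.
A saturated chain in the semigroup adds one node at a time, so that its genus is
`∑_i ∑_k (M_i[k] - 1) + ∑_i p_i`.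

Compatibility and genus both split when the tree is cut between the branches `t` and `t + 1`. If
`2 t ≤ r`, let `k`, `k'` be the genera of the trees on the first and on the last `t` branches, and
`p`, `p'` the gluing levels next to them. The part of the tree beyond one of these cuts contains the
other group of `t` branches, so `(2 k + p) + (2 k' + p') ≤ 2 n`; thus `2 k + p ≤ n` for the tree or
for its inverse. -/

namespace MultSeq

section PartialSums

variable (M : MultSeq) {a b : ℕ}

/-- The partial sum `m₁ + ⋯ + m_n`. These sums are the elements of the Arf numerical semigroup with
multiplicity sequence `M`. -/
def psum (n : ℕ) : ℕ := ∑ l ∈ Finset.range n, M.seq l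

@[simp] lemma psum_zero : M.psum 0 = 0 := Finset.sum_range_zero _

lemma psum_succ (n : ℕ) : M.psum (n + 1) = M.psum n + M.seq n := Finset.sum_range_succ _ _

lemma psum_strictMono : StrictMono M.psum :=
  strictMono_nat_of_lt_succ fun n => by simp [psum_succ, M.pos]

lemma psum_inj : M.psum a = M.psum b ↔ a = b := M.psum_strictMono.injective.eq_iff

lemma psum_le_psum : M.psum a ≤ M.psum b ↔ a ≤ b := M.psum_strictMono.le_iff_le

lemma psum_eq_psum_add_one_iff : M.psum b = M.psum a + 1 ↔ b = a + 1 ∧ M.seq a = 1 := by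
  constructor
  · intro h
    have hab : a < b := M.psum_strictMono.lt_iff_lt.1 (by omega)
    have hle : M.psum (a + 1) ≤ M.psum b := M.psum_le_psum.2 hab
    have hseq : M.seq a = 1 := by
      have := M.pos a
      rw [psum_succ] at hle
      omega
    exact ⟨M.psum_inj.1 (by rw [h, psum_succ, hseq]), hseq⟩
  · rintro ⟨rfl, hseq⟩
    rw [psum_succ, hseq]

lemma add_two_le_sumEnd (j : ℕ) : j + 2 ≤ M.sumEnd j := (Nat.find_spec (M.sum_eq j)).1

lemma psum_sumEnd (j : ℕ) : M.psum (M.sumEnd j) = M.psum (j + 1) + M.seq j := by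
  have hj : j + 1 ≤ M.sumEnd j := by have := M.add_two_le_sumEnd j; omega
  have hsum : M.seq j = ∑ l ∈ Finset.Ico (j + 1) (M.sumEnd j), M.seq l :=
    (Nat.find_spec (M.sum_eq j)).2
  rw [hsum, psum, psum, Finset.sum_range_add_sum_Ico _ hj]

variable {M}

lemma seq_eq_one_of_le (ha : M.seq a = 1) (hab : a ≤ b) : M.seq b = 1 :=
  le_antisymm (ha ▸ M.anti hab) (M.pos b)

lemma psum_add_of_seq_eq_one (ha : M.seq a = 1) (x : ℕ) : M.psum (a + x) = M.psum a + x := by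
  induction x with
  | zero => rfl
  | succ x ih => rw [← add_assoc, psum_succ, ih, seq_eq_one_of_le ha (by omega), add_assoc]

end PartialSums

section ArfSum

variable {M M' : MultSeq} {a a' b b' c c' e e' f p : ℕ}

/-- The Arf operation `β + γ - α` on the elements `α ≤ β, γ` of the numerical semigroup of `M`,
expressed through the numbers `a`, `b`, `c` and `e` of summands of `α`, `β`, `γ` and the result. -/
structure IsArfSum (M : MultSeq) (a b c e : ℕ) : Prop where
  le_left : a ≤ b
  le_right : a ≤ c
  psum_add_psum : M.psum e + M.psum a = M.psum b + M.psum c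

namespace IsArfSum

lemma symm (h : M.IsArfSum a b c e) : M.IsArfSum a c b e :=
  ⟨h.le_right, h.le_left, h.psum_add_psum.trans (add_comm _ _)⟩

lemma unique (h : M.IsArfSum a b c e) (h' : M.IsArfSum a b c e') : e = e' :=
  M.psum_inj.1 (Nat.add_right_cancel (h.psum_add_psum.trans h'.psum_add_psum.symm))

lemma right_le (h : M.IsArfSum a b c e) : c ≤ e := by
  have := h.psum_add_psum
  have := M.psum_le_psum.2 h.le_left
  exact M.psum_le_psum.1 (by omega)

lemma eq_right (h : M.IsArfSum a a c e) : e = c := by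
  have := h.psum_add_psum
  exact M.psum_inj.1 (by omega)

/-- This is `β + γ - α = (β + γ - α') + (2 α' - α) - α'` for the successor `α'` of `α`. -/
lemma of_succ (hf : M.IsArfSum (a + 1) b c f) (he : M.IsArfSum (a + 1) (M.sumEnd a) f e) :
    M.IsArfSum a b c e where
  le_left := (Nat.le_succ a).trans hf.le_left
  le_right := (Nat.le_succ a).trans hf.le_right
  psum_add_psum := by
    have := hf.psum_add_psum
    have := he.psum_add_psum
    have := M.psum_sumEnd a
    have := M.psum_succ a
    omega

end IsArfSum

lemma exists_isArfSum (M : MultSeq) (hab : a ≤ b) (hac : a ≤ c) : ∃ e, M.IsArfSum a b c e := by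
  obtain ⟨K, hK⟩ := M.eventually_one
  induction hn : K - a generalizing a b c with
  | zero =>
    have ha : M.seq a = 1 := hK a (by omega)
    obtain ⟨x, rfl⟩ := Nat.exists_eq_add_of_le hab
    obtain ⟨y, rfl⟩ := Nat.exists_eq_add_of_le hac
    refine ⟨a + (x + y), hab, hac, ?_⟩
    simp only [psum_add_of_seq_eq_one ha]
    ring
  | succ n ih =>
    rcases hab.eq_or_lt with rfl | hab
    · exact ⟨c, le_rfl, hac, add_comm _ _⟩
    rcases hac.eq_or_lt with rfl | hac
    · exact ⟨b, hab.le, le_rfl, rfl⟩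
    obtain ⟨f, hf⟩ := ih hab hac (by omega)
    have hs : a + 1 ≤ M.sumEnd a := by have := M.add_two_le_sumEnd a; omega
    obtain ⟨e, he⟩ := ih hs (hf.le_right.trans hf.right_le) (by omega)
    exact ⟨e, hf.of_succ he⟩

lemma IsArfSum.exists_succ (h : M.IsArfSum a b c e) (hab : a < b) (hac : a < c) :
    ∃ f, M.IsArfSum (a + 1) b c f ∧ M.IsArfSum (a + 1) (M.sumEnd a) f e := by
  obtain ⟨f, hf⟩ := M.exists_isArfSum (a := a + 1) hab hac
  have hs : a + 1 ≤ M.sumEnd a := by have := M.add_two_le_sumEnd a; omega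
  obtain ⟨g, hg⟩ := M.exists_isArfSum hs (hf.le_right.trans hf.right_le)
  exact ⟨f, hf, h.unique (hf.of_succ hg) ▸ hg⟩

lemma le_comp_iff :
    (p : ℕ∞) ≤ Comp M M' ↔ ∀ j, min (M.sumEnd j) p = min (M'.sumEnd j) p := by
  unfold Comp
  split_ifs with h
  · simp [h]
  · simp only [le_iInf_iff, Nat.cast_le]
    exact forall_congr' fun j => by omega

lemma comp_comm (M M' : MultSeq) : Comp M M' = Comp M' M := by
  obtain rfl | hne := eq_or_ne M M'
  · rfl
  · simp only [Comp, if_neg hne, if_neg hne.symm, ne_comm, min_comm]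

lemma IsArfSum.min_eq_min (hp : (p : ℕ∞) ≤ Comp M M') (h : M.IsArfSum a b c e)
    (h' : M'.IsArfSum a' b' c' e') (ha : min a p = min a' p) (hb : min b p = min b' p)
    (hc : min c p = min c' p) : min e p = min e' p := by
  induction hn : p - a generalizing a a' b b' c c' e e' with
  | zero =>
    have := h.le_right.trans h.right_le
    have := h'.le_right.trans h'.right_le
    omega
  | succ n ih =>
    obtain rfl : a = a' := by omega
    rcases h.le_left.eq_or_lt with rfl | hab
    · obtain rfl : a = b' := by omega
      rwa [h.eq_right, h'.eq_right]
    rcases h.le_right.eq_or_lt with rfl | hac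
    · obtain rfl : a = c' := by omega
      rwa [h.symm.eq_right, h'.symm.eq_right]
    obtain ⟨f, hf, he⟩ := h.exists_succ hab hac
    obtain ⟨f', hf', he'⟩ := h'.exists_succ (by omega) (by omega)
    have hff' : min f p = min f' p := ih hf hf' rfl hb hc (by omega)
    exact ih he he' rfl (le_comp_iff.1 hp a) hff' (by omega)

end ArfSum

section Genus

variable {M : MultSeq} {N : ℕ}

lemma exists_seq_eq_one (M : MultSeq) : ∃ K, M.seq K = 1 :=
  M.eventually_one.imp fun K hK => hK K le_rfl

/-- The number of entries of a multiplicity sequence that are greater than `1`. The partial sum of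
these entries is the conductor of the numerical semigroup. -/
def onset (M : MultSeq) : ℕ := Nat.find M.exists_seq_eq_one

lemma seq_onset (M : MultSeq) : M.seq M.onset = 1 := Nat.find_spec M.exists_seq_eq_one

lemma seq_eq_one_iff : M.seq N = 1 ↔ M.onset ≤ N :=
  ⟨Nat.find_min' M.exists_seq_eq_one, seq_eq_one_of_le M.seq_onset⟩

/-- The genus `∑ (m_k - 1)` of the numerical semigroup with multiplicity sequence `M`. -/
def genus (M : MultSeq) : ℤ := M.psum M.onset - M.onset

lemma genus_eq_psum_sub (h : M.seq N = 1) : M.genus = M.psum N - N := by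
  obtain ⟨x, rfl⟩ := Nat.exists_eq_add_of_le (seq_eq_one_iff.1 h)
  rw [genus, psum_add_of_seq_eq_one M.seq_onset]
  push_cast
  ring

lemma genus_nonneg (M : MultSeq) : 0 ≤ M.genus :=
  sub_nonneg.2 (Nat.cast_le.2 M.psum_strictMono.le_apply)

end Genus

end MultSeq

section SaturatedChains

variable {r n : ℕ} {S : Set (Fin r → ℕ)} {a b c : Fin r → ℕ}

lemma HasSaturatedChain.rank_eq {R : (Fin r → ℕ) → ℕ}
    (hR : ∀ a ∈ S, ∀ b ∈ S, a < b → ∃ c ∈ S, a < c ∧ c ≤ b ∧ R c = R a + 1)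
    (h : HasSaturatedChain S a b n) : R b = R a + n := by
  obtain ⟨α, hS, rfl, rfl, hα⟩ := h
  have hstep (i : Fin n) : R (α i.succ) = R (α i.castSucc) + 1 := by
    obtain ⟨c, hcS, hlt, hle, hc⟩ := hR _ (hS i.castSucc) _ (hS i.succ) (hα i).1
    rcases hle.eq_or_lt with rfl | hlt'
    · exact hc
    · exact absurd ⟨hlt, hlt'⟩ ((hα i).2 c hcS)
  have hrank (i : Fin (n + 1)) : R (α i) = R (α 0) + i := by
    induction i using Fin.induction with
    | zero => rfl
    | succ i ih => rw [hstep, ih, Fin.val_succ, Fin.val_castSucc, add_assoc]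
  simpa using hrank (Fin.last n)

lemma HasSaturatedChain.snoc (h : HasSaturatedChain S a b n) (hc : c ∈ S) (hbc : b < c)
    (hcov : ∀ s ∈ S, ¬(b < s ∧ s < c)) : HasSaturatedChain S a c (n + 1) := by
  obtain ⟨α, hS, rfl, rfl, hα⟩ := h
  refine ⟨Fin.snoc (α := fun _ => Fin r → ℕ) α c, fun i => ?_, ?_, Fin.snoc_last _ _, fun i => ?_⟩
  · cases i using Fin.lastCases with
    | last => rwa [Fin.snoc_last]
    | cast i => rw [Fin.snoc_castSucc]; exact hS i
  · rw [← Fin.castSucc_zero, Fin.snoc_castSucc]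
  · cases i using Fin.lastCases with
    | last => rw [Fin.succ_last, Fin.snoc_last, Fin.snoc_castSucc]; exact ⟨hbc, hcov⟩
    | cast i => rw [Fin.succ_castSucc, Fin.snoc_castSucc, Fin.snoc_castSucc]; exact hα i

lemma exists_hasSaturatedChain (ha : a ∈ S) (hb : b ∈ S) (hab : a ≤ b) :
    ∃ n, HasSaturatedChain S a b n := by
  induction b using WellFoundedLT.induction with
  | ind b ih =>
    rcases hab.eq_or_lt with rfl | hlt
    · exact ⟨0, fun _ => a, fun _ => ha, rfl, rfl, fun i => i.elim0⟩
    have hfin : {c | c ∈ S ∧ a ≤ c ∧ c < b}.Finite :=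
      (Set.finite_Icc a b).subset fun c hc => ⟨hc.2.1, hc.2.2.le⟩
    obtain ⟨c, -, ⟨hcS, hac, hcb⟩, hmax⟩ := hfin.exists_le_maximal ⟨ha, le_rfl, hlt⟩
    obtain ⟨n, hn⟩ := ih c hcb hcS hac
    refine ⟨n + 1, hn.snoc hb hcb fun s hs hcsb => ?_⟩
    exact hcsb.1.not_ge (hmax ⟨hs, hac.trans hcsb.1.le, hcsb.2⟩ hcsb.1.le)

lemma HasSaturatedChain.length_eq_sum (h : HasSaturatedChain Set.univ 0 b n) :
    n = ∑ i, b i := by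
  refine (Eq.trans (h.rank_eq (R := fun x => ∑ i, x i) ?_) (by simp)).symm
  intro a _ b _ hab
  obtain ⟨hle, i, hi⟩ := Pi.lt_def.1 hab
  refine ⟨a + Pi.single i 1, trivial, Pi.lt_def.2 ⟨le_self_add, i, by simp⟩, fun j => ?_, ?_⟩
  · rcases eq_or_ne j i with rfl | hj
    · simpa using hi
    · simpa [hj] using hle j
  · simp [Finset.sum_add_distrib]

end SaturatedChains

namespace UntwistedTree

variable {r : ℕ} {T : UntwistedTree r}

section Gluing

variable {i h k : Fin r} {j j' : ℕ} {m : Fin (r - 1)}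

/-- The left one of the two adjacent branches that are glued up to level `T.p m`. -/
def left (m : Fin (r - 1)) : Fin r := ⟨m, by omega⟩

/-- The right one of the two adjacent branches that are glued up to level `T.p m`. -/
def right (m : Fin (r - 1)) : Fin r := ⟨m + 1, by omega⟩

@[simp] lemma val_left (m : Fin (r - 1)) : (left m : ℕ) = m := rfl

@[simp] lemma val_right (m : Fin (r - 1)) : (right m : ℕ) = m + 1 := rfl

lemma right_ne_left (m : Fin (r - 1)) : right m ≠ left m := by simp [Fin.ext_iff]

lemma glued_refl (T : UntwistedTree r) (i : Fin r) (j : ℕ) : T.Glued i i j :=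
  fun m _ _ => by omega

lemma glued_zero (T : UntwistedTree r) (i h : Fin r) : T.Glued i h 0 := fun m _ _ => T.p_pos m

lemma Glued.symm (H : T.Glued i h j) : T.Glued h i j := fun m _ _ => H m (by omega) (by omega)

lemma Glued.trans (H : T.Glued i h j) (H' : T.Glued h k j) : T.Glued i k j := by
  intro m _ _
  by_cases hm : min (i : ℕ) h ≤ m ∧ (m : ℕ) < max (i : ℕ) h
  · exact H m hm.1 hm.2
  · exact H' m (by omega) (by omega)

lemma Glued.mono (H : T.Glued i h j) (hj : j' ≤ j) : T.Glued i h j' :=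
  fun m h₁ h₂ => (Nat.succ_le_succ hj).trans (H m h₁ h₂)

lemma glued_left_right_iff : T.Glued (left m) (right m) j ↔ j < T.p m := by
  refine ⟨fun H => H m (by simp) (by simp), fun H m' h₁ h₂ => ?_⟩
  obtain rfl : m' = m := Fin.ext (by simp only [val_left, val_right] at h₁ h₂; omega)
  exact H

lemma node_self (i : Fin r) (j : ℕ) : T.node i j i = (T.E i).seq j := if_pos (T.glued_refl i j)

lemma glued_of_node_ne_zero (H : T.node i j h ≠ 0) : T.Glued i h j :=
  of_not_not fun hn => H (if_neg hn)

lemma node_eq_node_iff : T.node i j = T.node h j ↔ T.Glued i h j := by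
  constructor
  · intro H
    apply glued_of_node_ne_zero
    rw [H, node_self]
    exact ((T.E h).pos j).ne'
  · intro H
    have hiff (k : Fin r) : T.Glued i k j ↔ T.Glued h k j := ⟨H.symm.trans, H.trans⟩
    exact funext fun k => by classical exact if_congr (hiff k) rfl rfl

/-- The highest level at which the branch `h` is glued to the preceding branch, and `0` if `h` is
the first branch. -/
def prevGlue (T : UntwistedTree r) (h : Fin r) : ℕ :=
  if hh : (h : ℕ) = 0 then 0 else T.p ⟨h - 1, by omega⟩

lemma prevGlue_right (m : Fin (r - 1)) : T.prevGlue (right m) = T.p m := by simp [prevGlue]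

lemma sum_prevGlue (T : UntwistedTree r) : ∑ h, T.prevGlue h = ∑ m, T.p m := by
  cases r with
  | zero => rfl
  | succ r =>
    rw [Fin.sum_univ_succ]
    exact (zero_add _).trans (Finset.sum_congr rfl fun m _ => T.prevGlue_right m)

lemma eq_right_of_val_ne_zero (hh : (h : ℕ) ≠ 0) : ∃ m, h = right m :=
  ⟨⟨h - 1, by omega⟩, Fin.ext (by simp only [val_right]; omega)⟩

lemma Glued.lt_prevGlue (H : T.Glued i h j) (hlt : i < h) : j < T.prevGlue h := by
  obtain ⟨m, rfl⟩ := eq_right_of_val_ne_zero (h := h) (by omega)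
  rw [prevGlue_right]
  have : (i : ℕ) < m + 1 := hlt
  exact H m (by simp only [val_right]; omega) (by simp only [val_right]; omega)

lemma exists_glued_prevGlue_le (T : UntwistedTree r) (h : Fin r) (j : ℕ) :
    ∃ i, T.Glued i h j ∧ T.prevGlue i ≤ j := by
  induction h using WellFoundedLT.induction with
  | ind h ih =>
    rcases le_or_gt (T.prevGlue h) j with hle | hlt
    · exact ⟨h, T.glued_refl h j, hle⟩
    have hh : (h : ℕ) ≠ 0 := fun hh => by simp [prevGlue, hh] at hlt
    obtain ⟨m, rfl⟩ := eq_right_of_val_ne_zero hh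
    rw [prevGlue_right] at hlt
    obtain ⟨i, hi, hij⟩ := ih (left m) (Nat.lt_succ_self (m : ℕ))
    exact ⟨i, hi.trans (glued_left_right_iff.2 hlt), hij⟩

end Gluing

section Depth

variable {d d' : Fin r → ℕ} {i h : Fin r} {j : ℕ}

/-- The depth vectors of subtrees: `d h` nodes on the branch `h`, where two adjacent branches either
have the same number of nodes or have both left the part where they are glued. -/
def IsDepth (T : UntwistedTree r) (d : Fin r → ℕ) : Prop :=
  ∀ m : Fin (r - 1), min (d (left m)) (T.p m) = min (d (right m)) (T.p m)

lemma isDepth_const (T : UntwistedTree r) (j : ℕ) : T.IsDepth fun _ => j := fun _ => rfl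

lemma isDepth_zero (T : UntwistedTree r) : T.IsDepth 0 := T.isDepth_const 0

lemma IsDepth.inf (hd : T.IsDepth d) (hd' : T.IsDepth d') : T.IsDepth (d ⊓ d') := by
  intro m
  have := hd m
  have := hd' m
  simp only [Pi.inf_apply]
  omega

lemma IsDepth.lt_iff_of_glued (hd : T.IsDepth d) (H : T.Glued i h j) : j < d i ↔ j < d h := by
  wlog hih : (i : ℕ) ≤ h generalizing i h
  · exact (this H.symm (le_of_not_ge hih)).symm
  obtain ⟨a, ha⟩ := i
  obtain ⟨b, hb⟩ := h
  induction b, (show a ≤ b from hih) using Nat.le_induction with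
  | base => rfl
  | succ b hab ih =>
    let m : Fin (r - 1) := ⟨b, by omega⟩
    have hm : j < T.p m := H m (by simp only [m]; omega) (by simp only [m]; omega)
    have hleft : T.Glued ⟨a, ha⟩ (left m) j := H.trans (glued_left_right_iff.2 hm).symm
    have hadj : j < d (left m) ↔ j < d (right m) := by have := hd m; omega
    exact (ih _ hleft hab).trans hadj

lemma IsDepth.eq_zero (hd : T.IsDepth d) (hi : d i = 0) : d = 0 := by
  funext h
  have := hd.lt_iff_of_glued (T.glued_zero i h)
  simp only [Pi.zero_apply]
  omega

/-- The sum of the nodes of the subtree with depth vector `d`. -/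
def depthSum (T : UntwistedTree r) (d : Fin r → ℕ) : Fin r → ℕ := fun h => (T.E h).psum (d h)

@[simp] lemma depthSum_apply (d : Fin r → ℕ) (h : Fin r) :
    T.depthSum d h = (T.E h).psum (d h) := rfl

@[simp] lemma depthSum_zero (T : UntwistedTree r) : T.depthSum 0 = 0 :=
  funext fun h => (T.E h).psum_zero

lemma depthSum_le_depthSum : T.depthSum d ≤ T.depthSum d' ↔ d ≤ d' :=
  forall_congr' fun h => (T.E h).psum_le_psum

lemma depthSum_lt_depthSum : T.depthSum d < T.depthSum d' ↔ d < d' :=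
  lt_iff_lt_of_le_iff_le' depthSum_le_depthSum depthSum_le_depthSum

lemma depthSum_injective (T : UntwistedTree r) : Function.Injective T.depthSum :=
  fun _ _ hd => funext fun h => (T.E h).psum_inj.1 (congrFun hd h)

lemma depthSum_inf (d d' : Fin r → ℕ) : T.depthSum (d ⊓ d') = T.depthSum d ⊓ T.depthSum d' :=
  funext fun h => (T.E h).psum_strictMono.monotone.map_min

end Depth

section Subtrees

variable {d d' : Fin r → ℕ} {h : Fin r} {j : ℕ} {V : Finset (ℕ × (Fin r → ℕ))}

/-- A finite set of nodes that contains the parent of each of its nodes: either empty or a rooted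
subtree. Allowing the empty set makes these sets correspond to all elements of the semigroup. -/
structure IsParentClosed (T : UntwistedTree r) (V : Finset (ℕ × (Fin r → ℕ))) : Prop where
  subset : ∀ v ∈ V, ∃ i j, v = (j, T.node i j)
  parent_mem : ∀ i j, (j + 1, T.node i (j + 1)) ∈ V → (j, T.node i j) ∈ V

lemma IsRootedSubtree.isParentClosed (hV : T.IsRootedSubtree V) : T.IsParentClosed V :=
  ⟨hV.subset, hV.parent_mem⟩

/-- The nodes among the first `d h` ones on some branch `h`. -/
noncomputable def truncation (T : UntwistedTree r) (d : Fin r → ℕ) :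
    Finset (ℕ × (Fin r → ℕ)) :=
  Finset.univ.biUnion fun h => (Finset.range (d h)).image fun j => (j, T.node h j)

lemma mem_truncation {v : ℕ × (Fin r → ℕ)} :
    v ∈ T.truncation d ↔ ∃ h, ∃ j < d h, (j, T.node h j) = v := by
  simp [truncation]

lemma IsDepth.mk_mem_truncation (hd : T.IsDepth d) :
    (j, T.node h j) ∈ T.truncation d ↔ j < d h := by
  rw [mem_truncation]
  constructor
  · rintro ⟨i, j', hj, heq⟩
    obtain ⟨rfl, hnode⟩ := Prod.mk.inj heq
    exact (hd.lt_iff_of_glued (node_eq_node_iff.1 hnode)).1 hj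
  · exact fun hj => ⟨h, j, hj, rfl⟩

lemma IsDepth.truncation_subset_iff (hd' : T.IsDepth d') :
    T.truncation d ⊆ T.truncation d' ↔ d ≤ d' := by
  constructor
  · intro hsub h
    by_contra! hlt
    exact lt_irrefl (d' h) (hd'.mk_mem_truncation.1 (hsub (mem_truncation.2 ⟨h, d' h, hlt, rfl⟩)))
  · intro hle v hv
    obtain ⟨h, j, hj, rfl⟩ := mem_truncation.1 hv
    exact mem_truncation.2 ⟨h, j, hj.trans_le (hle h), rfl⟩

lemma IsDepth.isParentClosed_truncation (hd : T.IsDepth d) :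
    T.IsParentClosed (T.truncation d) where
  subset v hv := by
    obtain ⟨h, j, -, rfl⟩ := mem_truncation.1 hv
    exact ⟨h, j, rfl⟩
  parent_mem i j hv := by
    rw [hd.mk_mem_truncation] at hv ⊢
    omega

lemma IsDepth.isRootedSubtree_truncation (hd : T.IsDepth d) (hd₀ : d ≠ 0) :
    T.IsRootedSubtree (T.truncation d) where
  subset := hd.isParentClosed_truncation.subset
  root_mem _ := hd.mk_mem_truncation.2 (Nat.pos_of_ne_zero fun hi => hd₀ (hd.eq_zero hi))
  parent_mem := hd.isParentClosed_truncation.parent_mem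

lemma IsParentClosed.exists_mem_iff_lt (hV : T.IsParentClosed V) (h : Fin r) :
    ∃ n, ∀ j, (j, T.node h j) ∈ V ↔ j < n := by
  have hinj : Function.Injective fun j => (j, T.node h j) := fun _ _ hab => congrArg Prod.fst hab
  have hex : ∃ j, (j, T.node h j) ∉ V := by
    by_contra! hmem
    exact Set.infinite_range_of_injective hinj
      (V.finite_toSet.subset (Set.range_subset_iff.2 hmem))
  have hdown (j k : ℕ) (hkj : k ≤ j) : (j, T.node h j) ∈ V → (k, T.node h k) ∈ V := by
    induction j, hkj using Nat.le_induction with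
    | base => exact id
    | succ j _ ih => exact fun hj => ih (hV.parent_mem h j hj)
  refine ⟨Nat.find hex, fun j => ⟨fun hj => ?_, fun hj => of_not_not (Nat.find_min hex hj)⟩⟩
  by_contra! hle
  exact Nat.find_spec hex (hdown j _ hle hj)

lemma IsParentClosed.exists_truncation_eq (hV : T.IsParentClosed V) :
    ∃ d, T.IsDepth d ∧ T.truncation d = V := by
  choose d hd using hV.exists_mem_iff_lt
  refine ⟨d, fun m => ?_, ?_⟩
  · have hadj (j : ℕ) (hj : j < T.p m) : j < d (left m) ↔ j < d (right m) := by
      rw [← hd, ← hd, node_eq_node_iff.2 (glued_left_right_iff.2 hj)]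
    have := hadj (d (left m))
    have := hadj (d (right m))
    omega
  · ext v
    rw [mem_truncation]
    constructor
    · rintro ⟨h, j, hj, rfl⟩
      exact (hd h j).2 hj
    · intro hv
      obtain ⟨h, j, rfl⟩ := hV.subset v hv
      exact ⟨h, j, (hd h j).1 hv, rfl⟩

lemma IsDepth.sum_truncation (hd : T.IsDepth d) :
    ∑ v ∈ T.truncation d, v.2 = T.depthSum d := by
  funext h
  rw [Finset.sum_apply, depthSum, MultSeq.psum]
  have hsub : (Finset.range (d h)).image (fun j => (j, T.node h j)) ⊆ T.truncation d :=
    Finset.subset_biUnion_of_mem (fun h => (Finset.range (d h)).image fun j => (j, T.node h j))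
      (Finset.mem_univ h)
  rw [← Finset.sum_subset hsub, Finset.sum_image]
  · exact Finset.sum_congr rfl fun j _ => node_self h j
  · exact fun _ _ _ _ hab => congrArg Prod.fst hab
  · intro v hv hv'
    obtain ⟨i, j, hj, rfl⟩ := mem_truncation.1 hv
    by_contra hne
    have hglued : T.Glued i h j := glued_of_node_ne_zero hne
    rw [node_eq_node_iff.2 hglued] at hv'
    exact hv' (Finset.mem_image_of_mem _
      (Finset.mem_range.2 ((hd.lt_iff_of_glued hglued).1 hj)))

/-- Each node is counted on the leftmost branch that passes through it. The subtraction is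
truncated: the branch `h` may end before it leaves the preceding one. -/
lemma IsDepth.card_truncation (hd : T.IsDepth d) :
    (T.truncation d).card = ∑ h, (d h - T.prevGlue h) := by
  simp only [← Nat.card_Ico, ← Finset.card_sigma]
  refine (Finset.card_nbij (fun x => (x.2, T.node x.1 x.2)) ?_ ?_ ?_).symm
  · rintro ⟨h, j⟩ hx
    simp only [Finset.coe_sigma, Set.mem_sigma_iff, Finset.coe_Ico, Set.mem_Ico] at hx
    exact mem_truncation.2 ⟨h, j, hx.2.2, rfl⟩
  · rintro ⟨h, j⟩ hx ⟨h', j'⟩ hx' heq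
    simp only [Finset.coe_sigma, Set.mem_sigma_iff, Finset.coe_Ico, Set.mem_Ico] at hx hx'
    obtain ⟨rfl, hnode⟩ := Prod.mk.inj heq
    have hglued : T.Glued h h' j := node_eq_node_iff.1 hnode
    rcases lt_trichotomy h h' with hlt | rfl | hlt
    · exact absurd (hglued.lt_prevGlue hlt) hx'.2.1.not_gt
    · rfl
    · exact absurd (hglued.symm.lt_prevGlue hlt) hx.2.1.not_gt
  · intro v hv
    obtain ⟨h, j, hj, rfl⟩ := mem_truncation.1 hv
    obtain ⟨i, hi, hij⟩ := T.exists_glued_prevGlue_le h j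
    refine ⟨⟨i, j⟩, ?_, Prod.ext rfl (node_eq_node_iff.2 hi)⟩
    simpa using ⟨hij, (hd.lt_iff_of_glued hi).2 hj⟩

lemma IsDepth.exists_card_truncation_eq_add_one (hd : T.IsDepth d) (hd' : T.IsDepth d')
    (hlt : d < d') :
    ∃ e, T.IsDepth e ∧ d < e ∧ e ≤ d' ∧
      (T.truncation e).card = (T.truncation d).card + 1 := by
  obtain ⟨hle, i, hi⟩ := Pi.lt_def.1 hlt
  have hnotMem : (d i, T.node i (d i)) ∉ T.truncation d := by simp [hd.mk_mem_truncation]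
  have hclosed : T.IsParentClosed (insert (d i, T.node i (d i)) (T.truncation d)) := by
    refine ⟨fun v hv => ?_, fun h j hv => Finset.mem_insert_of_mem ?_⟩
    · rcases Finset.mem_insert.1 hv with rfl | hv
      · exact ⟨i, d i, rfl⟩
      · exact hd.isParentClosed_truncation.subset v hv
    · rcases Finset.mem_insert.1 hv with heq | hv
      · obtain ⟨hj, hnode⟩ := Prod.mk.inj heq
        rw [← hj, node_eq_node_iff] at hnode
        rw [hd.mk_mem_truncation, hd.lt_iff_of_glued (hnode.mono j.le_succ), ← hj]
        exact j.lt_succ_self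
      · exact hd.isParentClosed_truncation.parent_mem h j hv
  obtain ⟨e, he, heq⟩ := hclosed.exists_truncation_eq
  have hcard : (T.truncation e).card = (T.truncation d).card + 1 := by
    rw [heq, Finset.card_insert_of_notMem hnotMem]
  refine ⟨e, he, lt_of_le_of_ne ?_ ?_, ?_, hcard⟩
  · exact he.truncation_subset_iff.1 (heq ▸ Finset.subset_insert _ _)
  · rintro rfl
    omega
  · rw [← hd'.truncation_subset_iff, heq]
    exact Finset.insert_subset (hd'.mk_mem_truncation.2 hi) (hd'.truncation_subset_iff.2 hle)

end Subtrees

section Semigroup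

variable {S : AddSubmonoid (Fin r → ℕ)} {d e x : Fin r → ℕ}

lemma isMultiplicityTreeOf_iff :
    T.IsMultiplicityTreeOf S ↔ ∀ x, x ∈ S ↔ ∃ d, T.IsDepth d ∧ T.depthSum d = x := by
  rw [IsMultiplicityTreeOf, Set.ext_iff]
  refine forall_congr' fun x => iff_congr Iff.rfl ⟨?_, ?_⟩
  · rintro (rfl | ⟨V, hV, rfl⟩)
    · exact ⟨0, T.isDepth_zero, T.depthSum_zero⟩
    · obtain ⟨d, hd, rfl⟩ := hV.isParentClosed.exists_truncation_eq
      exact ⟨d, hd, hd.sum_truncation.symm⟩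
  · rintro ⟨d, hd, rfl⟩
    rcases eq_or_ne d 0 with rfl | hd₀
    · exact Or.inl T.depthSum_zero
    · exact Or.inr ⟨_, hd.isRootedSubtree_truncation hd₀, hd.sum_truncation.symm⟩

lemma IsMultiplicityTreeOf.mem_iff (hS : T.IsMultiplicityTreeOf S) :
    x ∈ S ↔ ∃ d, T.IsDepth d ∧ T.depthSum d = x := isMultiplicityTreeOf_iff.1 hS x

lemma IsMultiplicityTreeOf.depthSum_mem (hS : T.IsMultiplicityTreeOf S) (hd : T.IsDepth d) :
    T.depthSum d ∈ S := hS.mem_iff.2 ⟨d, hd, rfl⟩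

lemma IsMultiplicityTreeOf.isLocalSemigroup (hS : T.IsMultiplicityTreeOf S) :
    IsLocalSemigroup S := by
  rintro _ ha ⟨i, hi⟩
  obtain ⟨d, hd, rfl⟩ := hS.mem_iff.1 ha
  have hdi : d i = 0 := (T.E i).psum_inj.1 (by simpa using hi)
  rw [hd.eq_zero hdi, depthSum_zero]

/-- At depth `d` all branches have separated and all multiplicities have become `1`. -/
structure ResolvedAt (T : UntwistedTree r) (d : Fin r → ℕ) : Prop where
  seq_eq_one : ∀ h, (T.E h).seq (d h) = 1
  le_left : ∀ m, T.p m ≤ d (left m)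
  le_right : ∀ m, T.p m ≤ d (right m)

namespace ResolvedAt

lemma isDepth (hd : T.ResolvedAt d) : T.IsDepth d := fun m => by
  rw [min_eq_right (hd.le_left m), min_eq_right (hd.le_right m)]

lemma mono (hd : T.ResolvedAt d) (hde : d ≤ e) : T.ResolvedAt e where
  seq_eq_one h := MultSeq.seq_eq_one_of_le (hd.seq_eq_one h) (hde h)
  le_left m := (hd.le_left m).trans (hde _)
  le_right m := (hd.le_right m).trans (hde _)

lemma prevGlue_le (hd : T.ResolvedAt d) (h : Fin r) : T.prevGlue h ≤ d h := by
  by_cases hh : (h : ℕ) = 0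
  · simp [prevGlue, hh]
  · obtain ⟨m, rfl⟩ := eq_right_of_val_ne_zero hh
    exact T.prevGlue_right m ▸ hd.le_right m

lemma exists_depthSum_eq (hd : T.ResolvedAt d) (hx : T.depthSum d ≤ x) :
    ∃ e, T.IsDepth e ∧ T.depthSum e = x := by
  refine ⟨d + (x - T.depthSum d), (hd.mono le_self_add).isDepth, funext fun h => ?_⟩
  rw [depthSum_apply, Pi.add_apply, MultSeq.psum_add_of_seq_eq_one (hd.seq_eq_one h)]
  exact Nat.add_sub_cancel' (hx h)

end ResolvedAt

/-- The depth vector of the conductor. -/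
def conductorDepth (T : UntwistedTree r) : Fin r → ℕ := fun h =>
  max (T.E h).onset ((Finset.univ.filter fun m => left m = h ∨ right m = h).sup T.p)

lemma isLeast_conductorDepth (T : UntwistedTree r) :
    IsLeast {d | T.ResolvedAt d} T.conductorDepth := by
  have hle {m : Fin (r - 1)} {h : Fin r} (hm : left m = h ∨ right m = h) :
      T.p m ≤ T.conductorDepth h :=
    le_max_of_le_right (Finset.le_sup (f := T.p) (by simpa using hm))
  refine ⟨⟨fun h => MultSeq.seq_eq_one_iff.2 (le_max_left _ _), fun m => hle (Or.inl rfl),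
    fun m => hle (Or.inr rfl)⟩, fun d hd h => ?_⟩
  refine max_le (MultSeq.seq_eq_one_iff.1 (hd.seq_eq_one h)) (Finset.sup_le fun m hm => ?_)
  rcases (Finset.mem_filter.1 hm).2 with rfl | rfl
  · exact hd.le_left m
  · exact hd.le_right m

lemma IsMultiplicityTreeOf.isGoodSemigroup (hS : T.IsMultiplicityTreeOf S) :
    IsGoodSemigroup S where
  inf_mem _ hx _ hy := by
    obtain ⟨a, ha, rfl⟩ := hS.mem_iff.1 hx
    obtain ⟨b, hb, rfl⟩ := hS.mem_iff.1 hy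
    exact depthSum_inf a b ▸ hS.depthSum_mem (ha.inf hb)
  exists_gt _ hx _ hy i hi := by
    obtain ⟨a, ha, rfl⟩ := hS.mem_iff.1 hx
    obtain ⟨b, hb, rfl⟩ := hS.mem_iff.1 hy
    let e : Fin r → ℕ := fun h => if a h = b h then a h + 1 else min (a h) (b h)
    have he : T.IsDepth e := fun m => by
      have := ha m
      have := hb m
      grind
    have hmin (j : Fin r) :
        min (T.depthSum a j) (T.depthSum b j) = (T.E j).psum (min (a j) (b j)) :=
      congrFun (depthSum_inf a b).symm j
    have hab : a i = b i := (T.E i).psum_inj.1 hi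
    refine ⟨T.depthSum e, hS.depthSum_mem he, ?_, fun j _ => ?_, fun j _ hj => ?_⟩
    · exact (T.E i).psum_strictMono (by simp [e, hab])
    · rw [hmin]
      exact (T.E j).psum_le_psum.2 (by grind)
    · have hne : a j ≠ b j := fun h => hj (by simp only [depthSum_apply, h])
      rw [hmin, depthSum_apply, show e j = min (a j) (b j) from if_neg hne]
  exists_cone :=
    have hres := T.isLeast_conductorDepth.1
    ⟨_, hS.depthSum_mem hres.isDepth, fun _ hx => hS.mem_iff.2 (hres.exists_depthSum_eq hx)⟩

/-- Adjacent branches are glued at most up to the level at which their multiplicity sequences are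
compatible. -/
def IsCompatible (T : UntwistedTree r) : Prop :=
  ∀ m, (T.p m : ℕ∞) ≤ Comp (T.E (left m)) (T.E (right m))

lemma IsCompatible.exists_isArfSum {a b c : Fin r → ℕ} (hT : T.IsCompatible) (ha : T.IsDepth a)
    (hb : T.IsDepth b) (hc : T.IsDepth c) (hab : a ≤ b) (hac : a ≤ c) :
    ∃ e, T.IsDepth e ∧ ∀ h, (T.E h).IsArfSum (a h) (b h) (c h) (e h) := by
  choose e he using fun h => (T.E h).exists_isArfSum (hab h) (hac h)
  exact ⟨e, fun m => (he _).min_eq_min (hT m) (he _) (ha m) (hb m) (hc m), he⟩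

lemma IsCompatible.exists_isMultiplicityTreeOf (hT : T.IsCompatible) :
    ∃ S, T.IsMultiplicityTreeOf S := by
  let S : AddSubmonoid (Fin r → ℕ) :=
    { carrier := {x | ∃ d, T.IsDepth d ∧ T.depthSum d = x}
      zero_mem' := ⟨0, T.isDepth_zero, T.depthSum_zero⟩
      add_mem' := by
        rintro _ _ ⟨b, hb, rfl⟩ ⟨c, hc, rfl⟩
        obtain ⟨e, he, hsum⟩ := hT.exists_isArfSum T.isDepth_zero hb hc bot_le bot_le
        exact ⟨e, he, funext fun h => by simpa using (hsum h).psum_add_psum⟩ }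
  exact ⟨S, isMultiplicityTreeOf_iff.2 fun _ => Iff.rfl⟩

lemma IsMultiplicityTreeOf.isArfSemigroup (hS : T.IsMultiplicityTreeOf S) (hT : T.IsCompatible) :
    IsArfSemigroup S := by
  intro α hα x y hx hy
  obtain ⟨a, ha, rfl⟩ := hS.mem_iff.1 hα
  obtain ⟨b, hb, hbx⟩ := hS.mem_iff.1 hx
  obtain ⟨c, hc, hcy⟩ := hS.mem_iff.1 hy
  have hab : a ≤ b := depthSum_le_depthSum.1 (hbx ▸ le_self_add)
  have hac : a ≤ c := depthSum_le_depthSum.1 (hcy ▸ le_self_add)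
  obtain ⟨e, he, hsum⟩ := hT.exists_isArfSum ha hb hc hab hac
  refine hS.mem_iff.2 ⟨e, he, funext fun h => ?_⟩
  have hbh := congrFun hbx h
  have hch := congrFun hcy h
  have := (hsum h).psum_add_psum
  simp only [depthSum_apply, Pi.add_apply] at hbh hch ⊢
  omega

lemma IsMultiplicityTreeOf.isCompatible (hS : T.IsMultiplicityTreeOf S) (hA : IsArfSemigroup S) :
    T.IsCompatible := by
  refine fun m => MultSeq.le_comp_iff.2 fun j => ?_
  let x : Fin r → ℕ := fun h => (T.E h).seq j
  have hx : T.depthSum (fun _ => j) + x ∈ S := by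
    have hsucc : T.depthSum (fun _ => j + 1) = T.depthSum (fun _ => j) + x :=
      funext fun h => (T.E h).psum_succ j
    exact hsucc ▸ hS.depthSum_mem (T.isDepth_const (j + 1))
  obtain ⟨d, hd, hsum⟩ := hS.mem_iff.1 (hA _ (hS.depthSum_mem (T.isDepth_const j)) x x hx hx)
  have hsumEnd (h : Fin r) : d h = (T.E h).sumEnd j := by
    rw [← (T.E h).psum_inj, (T.E h).psum_sumEnd, (T.E h).psum_succ, add_assoc]
    exact congrFun hsum h
  rw [← hsumEnd, ← hsumEnd]
  exact hd m

end Semigroup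

section Genus

variable {S : AddSubmonoid (Fin r → ℕ)} {d : Fin r → ℕ} {n : ℕ} {g : ℤ}

lemma IsMultiplicityTreeOf.length_eq_card (hS : T.IsMultiplicityTreeOf S)
    (h : HasSaturatedChain (S : Set (Fin r → ℕ)) 0 (T.depthSum d) n) :
    n = (T.truncation d).card := by
  have hinv (d : Fin r → ℕ) : Function.invFun T.depthSum (T.depthSum d) = d :=
    Function.leftInverse_invFun T.depthSum_injective d
  have hrank := h.rank_eq (R := fun x => (T.truncation (Function.invFun T.depthSum x)).card) ?_
  · rw [← T.depthSum_zero] at hrank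
    simpa only [hinv, T.isDepth_zero.card_truncation, Pi.zero_apply, zero_tsub,
      Finset.sum_const_zero, zero_add] using hrank.symm
  · intro a ha b hb hab
    obtain ⟨d, hd, rfl⟩ := hS.mem_iff.1 ha
    obtain ⟨d', hd', rfl⟩ := hS.mem_iff.1 hb
    obtain ⟨e, he, hde, hed', hcard⟩ :=
      hd.exists_card_truncation_eq_add_one hd' (depthSum_lt_depthSum.1 hab)
    refine ⟨T.depthSum e, hS.depthSum_mem he, depthSum_lt_depthSum.2 hde,
      depthSum_le_depthSum.2 hed', ?_⟩
    simpa only [hinv] using hcard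

lemma IsMultiplicityTreeOf.resolvedAt (hS : T.IsMultiplicityTreeOf S) (hd : T.IsDepth d)
    (hcone : ∀ x, T.depthSum d ≤ x → x ∈ S) : T.ResolvedAt d := by
  have hsingle (h : Fin r) : ∃ e, T.IsDepth e ∧ e h = d h + 1 ∧ (T.E h).seq (d h) = 1 ∧
      ∀ k, k ≠ h → e k = d k := by
    obtain ⟨e, he, hsum⟩ := hS.mem_iff.1 (hcone (T.depthSum d + Pi.single h 1) le_self_add)
    have hh : (T.E h).psum (e h) = (T.E h).psum (d h) + 1 := by simpa using congrFun hsum h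
    obtain ⟨heh, hseq⟩ := (T.E h).psum_eq_psum_add_one_iff.1 hh
    refine ⟨e, he, heh, hseq, fun k hk => (T.E k).psum_inj.1 ?_⟩
    simpa [hk] using congrFun hsum k
  have hleft (m : Fin (r - 1)) : T.p m ≤ d (left m) := by
    obtain ⟨e, he, hel, -, her⟩ := hsingle (left m)
    have hdm := hd m
    have hem := he m
    rw [hel, her _ (right_ne_left m)] at hem
    omega
  refine ⟨fun h => (hsingle h).choose_spec.2.2.1, hleft, fun m => ?_⟩
  have := hleft m
  have := hd m
  omega

lemma IsMultiplicityTreeOf.isConductor (hS : T.IsMultiplicityTreeOf S) :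
    IsConductor S (T.depthSum T.conductorDepth) := by
  obtain ⟨hres, hleast⟩ := T.isLeast_conductorDepth
  refine ⟨fun x hx => hS.mem_iff.2 (hres.exists_depthSum_eq hx), fun c hc => ?_⟩
  obtain ⟨d, hd, rfl⟩ := hS.mem_iff.1 (hc c le_rfl)
  exact depthSum_le_depthSum.2 (hleast (hS.resolvedAt hd hc))

/-- The genus of the semigroup with multiplicity tree `T`, see
`IsMultiplicityTreeOf.hasGenus_iff`. -/
def genus (T : UntwistedTree r) : ℤ := ∑ h, (T.E h).genus + ∑ m, (T.p m : ℤ)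

lemma ResolvedAt.genus_eq (hd : T.ResolvedAt d) :
    T.genus = ((∑ h, T.depthSum d h : ℕ) : ℤ) - (T.truncation d).card := by
  have hglue : ∑ m, (T.p m : ℤ) = ∑ h, (T.prevGlue h : ℤ) := by
    exact_mod_cast T.sum_prevGlue.symm
  rw [hd.isDepth.card_truncation, genus, hglue]
  push_cast [Nat.cast_sub (hd.prevGlue_le _)]
  simp only [MultSeq.genus_eq_psum_sub (hd.seq_eq_one _), Finset.sum_sub_distrib, depthSum_apply]
  ring

lemma IsMultiplicityTreeOf.hasGenus_iff (hS : T.IsMultiplicityTreeOf S) :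
    HasGenus S g ↔ g = T.genus := by
  have heq {g : ℤ} (hg : HasGenus S g) : g = T.genus := by
    obtain ⟨δ, hδ, d₁, d₂, h₁, h₂, rfl⟩ := hg
    obtain rfl := hδ.unique hS.isConductor
    rw [T.isLeast_conductorDepth.1.genus_eq, h₁.length_eq_sum, hS.length_eq_card h₂]
  refine ⟨heq, ?_⟩
  rintro rfl
  obtain ⟨d₁, h₁⟩ := exists_hasSaturatedChain (Set.mem_univ 0)
    (Set.mem_univ (T.depthSum T.conductorDepth)) bot_le
  obtain ⟨d₂, h₂⟩ := exists_hasSaturatedChain (S := (S : Set (Fin r → ℕ))) S.zero_mem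
    (hS.isConductor.1 _ le_rfl) bot_le
  have hg : HasGenus S (d₁ - d₂) := ⟨_, hS.isConductor, d₁, d₂, h₁, h₂, rfl⟩
  rwa [← heq hg]

lemma mem_gen_iff : T ∈ Gen r g ↔ T.IsCompatible ∧ g = T.genus := by
  constructor
  · rintro ⟨S, -, -, hA, hS, hg⟩
    exact ⟨hS.isCompatible hA, hS.hasGenus_iff.1 hg⟩
  · rintro ⟨hT, hg⟩
    obtain ⟨S, hS⟩ := hT.exists_isMultiplicityTreeOf
    exact ⟨S, hS.isGoodSemigroup, hS.isLocalSemigroup, hS.isArfSemigroup hT, hS,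
      hS.hasGenus_iff.2 hg⟩

lemma sub_one_le_genus (T : UntwistedTree r) : (r : ℤ) - 1 ≤ T.genus := by
  have hE : 0 ≤ ∑ h, (T.E h).genus := Finset.sum_nonneg fun h _ => (T.E h).genus_nonneg
  have hp : r - 1 ≤ ∑ m, T.p m := by
    simpa using Finset.card_nsmul_le_sum Finset.univ T.p 1 fun m _ => T.p_pos m
  rw [genus, ← Nat.cast_sum]
  omega

end Genus

section Cutting

variable {t : ℕ}

lemma sum_fin_eq_sum_add_sum {A : Type*} [AddCommMonoid A] {n a b : ℕ} (hn : a + b = n)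
    (f : Fin n → A) :
    ∑ i, f i = ∑ i : Fin a, f ⟨i, by omega⟩ + ∑ i : Fin b, f ⟨a + i, by omega⟩ := by
  subst hn
  exact Fin.sum_univ_add f

lemma genus_eq_take_add_drop (T : UntwistedTree r) (ht : 1 ≤ t) (htr : t < r) :
    T.genus = (T.take t htr.le).genus + T.p ⟨t - 1, by omega⟩ + (T.drop t).genus := by
  have hE := sum_fin_eq_sum_add_sum (Nat.add_sub_cancel' htr.le) fun i => (T.E i).genus
  have hp := sum_fin_eq_sum_add_sum (show t + (r - t - 1) = r - 1 by omega) fun m => (T.p m : ℤ)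
  have hpt := sum_fin_eq_sum_add_sum (Nat.sub_add_cancel ht)
    fun m : Fin t => (T.p ⟨m, by omega⟩ : ℤ)
  rw [Fin.sum_univ_one] at hpt
  simp only [genus, take, drop, hE, hp, hpt, Fin.val_zero, add_zero]
  ring

lemma genus_take_le (T : UntwistedTree r) (htr : t ≤ r) : (T.take t htr).genus ≤ T.genus := by
  have hE := sum_fin_eq_sum_add_sum (Nat.add_sub_cancel' htr) fun i => (T.E i).genus
  have hp := sum_fin_eq_sum_add_sum (Nat.add_sub_cancel' (Nat.sub_le_sub_right htr 1))
    fun m => (T.p m : ℤ)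
  rw [genus, genus, hE, hp]
  exact add_le_add
    (le_add_of_nonneg_right (Finset.sum_nonneg fun _ _ => MultSeq.genus_nonneg _))
    (le_add_of_nonneg_right (Finset.sum_nonneg fun _ _ => Nat.cast_nonneg _))

lemma isCompatible_iff_take_drop (T : UntwistedTree r) (ht : 1 ≤ t) (htr : t < r) :
    T.IsCompatible ↔ (T.take t htr.le).IsCompatible ∧ (T.drop t).IsCompatible ∧
      (T.p ⟨t - 1, by omega⟩ : ℕ∞) ≤ Comp (T.E ⟨t - 1, by omega⟩) (T.E ⟨t, htr⟩) := by
  obtain ⟨s, rfl⟩ := Nat.exists_eq_add_of_le' ht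
  refine ⟨fun hT => ⟨fun m => hT ⟨m, by omega⟩, fun m => hT ⟨s + 1 + m, by omega⟩,
    hT ⟨s, by omega⟩⟩, ?_⟩
  rintro ⟨htake, hdrop, hcut⟩ ⟨m, hm⟩
  rcases lt_trichotomy m s with hms | rfl | hms
  · exact htake ⟨m, hms⟩
  · exact hcut
  · obtain ⟨x, rfl⟩ := Nat.exists_eq_add_of_le (show s + 1 ≤ m from hms)
    exact hdrop ⟨x, by omega⟩

lemma mem_iSet_iff {n k : ℤ} {p : ℕ} (ht : 1 ≤ t) (htr : t < r) :
    T ∈ ISet r n t p k ht htr ↔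
      T ∈ Gen r n ∧ T.p ⟨t - 1, by omega⟩ = p ∧ (T.take t htr.le).genus = k := by
  have hgenus := T.genus_eq_take_add_drop ht htr
  simp only [ISet, Set.mem_ofPred_eq, mem_gen_iff, T.isCompatible_iff_take_drop ht htr]
  constructor
  · rintro ⟨⟨htake, rfl⟩, ⟨hdrop, hk⟩, rfl, hcut⟩
    exact ⟨⟨⟨htake, hdrop, hcut⟩, by omega⟩, rfl, rfl⟩
  · rintro ⟨⟨⟨htake, hdrop, hcut⟩, rfl⟩, rfl, rfl⟩
    exact ⟨⟨htake, rfl⟩, ⟨hdrop, by omega⟩, rfl, hcut⟩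

lemma p_le_of_mem_gen {n : ℤ} (hT : T ∈ Gen r n) (ht : 1 ≤ t) (htr : t < r) :
    (T.p ⟨t - 1, by omega⟩ : ℤ) ≤ n - r + 2 := by
  have := T.genus_eq_take_add_drop ht htr
  have := (T.take t htr.le).sub_one_le_genus
  have := (T.drop t).sub_one_le_genus
  have := (mem_gen_iff.1 hT).2
  omega

end Cutting

section Reverse

variable {t : ℕ}

@[simp] lemma reverse_reverse (T : UntwistedTree r) : T.reverse.reverse = T := by
  ext1 <;> funext i <;> simp [reverse]

lemma left_rev (m : Fin (r - 1)) : left m.rev = (right m).rev :=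
  Fin.ext (by simp only [val_left, val_right, Fin.val_rev]; omega)

lemma right_rev (m : Fin (r - 1)) : right m.rev = (left m).rev :=
  Fin.ext (by simp only [val_left, val_right, Fin.val_rev]; omega)

lemma IsCompatible.reverse (hT : T.IsCompatible) : T.reverse.IsCompatible := by
  intro m
  have hm := hT m.rev
  rwa [left_rev, right_rev, MultSeq.comp_comm] at hm

lemma genus_reverse (T : UntwistedTree r) : T.reverse.genus = T.genus :=
  congrArg₂ (· + ·) (Equiv.sum_comp Fin.revPerm fun i => (T.E i).genus)
    (Equiv.sum_comp Fin.revPerm fun m => (T.p m : ℤ))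

lemma reverse_mem_gen {n : ℤ} (hT : T ∈ Gen r n) : T.reverse ∈ Gen r n := by
  rw [mem_gen_iff] at hT ⊢
  exact ⟨hT.1.reverse, hT.2.trans T.genus_reverse.symm⟩

lemma take_reverse (T : UntwistedTree r) (htr : t ≤ r - t) :
    T.reverse.take t (by omega) = (T.drop t).reverse.take t htr := by
  ext1
  · exact funext fun i => congrArg T.E (Fin.ext (by simp only [Fin.val_rev]; omega))
  · exact funext fun m => congrArg T.p (Fin.ext (by simp only [Fin.val_rev]; omega))

lemma genus_take_reverse_le_genus_drop (T : UntwistedTree r) (htr : t ≤ r - t) :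
    (T.reverse.take t (by omega)).genus ≤ (T.drop t).genus := by
  rw [T.take_reverse htr, ← (T.drop t).genus_reverse]
  exact genus_take_le _ htr

lemma two_mul_genus_take_add_p_le_or_reverse (T : UntwistedTree r) (ht : 1 ≤ t)
    (htr : 2 * t ≤ r) :
    2 * (T.take t (by omega)).genus + T.p ⟨t - 1, by omega⟩ ≤ T.genus ∨
      2 * (T.reverse.take t (by omega)).genus + T.reverse.p ⟨t - 1, by omega⟩ ≤ T.genus := by
  have hcut := T.genus_eq_take_add_drop ht (by omega)
  have hcut' := T.reverse.genus_eq_take_add_drop ht (by omega)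
  have hle := T.genus_take_reverse_le_genus_drop (t := t) (by omega)
  have hle' := T.reverse.genus_take_reverse_le_genus_drop (t := t) (by omega)
  rw [reverse_reverse] at hle'
  rw [genus_reverse] at hcut'
  omega

lemma exists_mem_iSet_or_reverse_mem_iSet {n : ℤ} (hT : T ∈ Gen r n) (ht : 1 ≤ t)
    (htr : 2 * t ≤ r) :
    ∃ (p : ℕ) (k : ℤ), (1 ≤ p ∧ (p : ℤ) ≤ n - r + 2) ∧ ((t : ℤ) - 1 ≤ k ∧ 2 * k + p ≤ n) ∧
      (T ∈ ISet r n t p k ht (by omega) ∨ T.reverse ∈ ISet r n t p k ht (by omega)) := by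
  have hor := T.two_mul_genus_take_add_p_le_or_reverse ht htr
  rw [← (mem_gen_iff.1 hT).2] at hor
  have hT' := reverse_mem_gen hT
  obtain hle | hle := hor
  · exact ⟨_, _, ⟨T.p_pos _, p_le_of_mem_gen hT ht (by omega)⟩,
      ⟨sub_one_le_genus _, hle⟩, Or.inl ((mem_iSet_iff ht _).2 ⟨hT, rfl, rfl⟩)⟩
  · exact ⟨_, _, ⟨T.reverse.p_pos _, p_le_of_mem_gen hT' ht (by omega)⟩,
      ⟨sub_one_le_genus _, hle⟩, Or.inr ((mem_iSet_iff ht _).2 ⟨hT', rfl, rfl⟩)⟩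

end Reverse

end UntwistedTree

theorem mainTheorem3 (r n t : ℕ) (ht : 1 ≤ t) (htr : 2 * t ≤ r) (lam : ℕ → ℤ)
    (hlam : ∀ p : ℕ, 1 ≤ p → (p : ℤ) ≤ (n : ℤ) - r + 2 →
      ((n : ℚ) - p - 1) / 2 ≤ (lam p : ℚ)) :
    Gen r n =
      ⋃ (p : ℕ) (_ : 1 ≤ p ∧ (p : ℤ) ≤ (n : ℤ) - r + 2)
        (k : ℤ) (_ : (t : ℤ) - 1 ≤ k ∧ k ≤ lam p),
        (ISet r n t p k ht (by omega) ∪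
          UntwistedTree.reverse '' ISet r n t p k ht (by omega)) := by
  ext T
  simp only [Set.mem_iUnion, Set.mem_union, Set.mem_image, exists_prop]
  constructor
  · intro hT
    obtain ⟨p, k, hp, ⟨htk, hk⟩, hmem⟩ :=
      UntwistedTree.exists_mem_iSet_or_reverse_mem_iSet hT ht htr
    have hk_le : k ≤ lam p := by
      have hlam' : (n : ℤ) - p - 1 ≤ lam p * 2 := by
        exact_mod_cast (div_le_iff₀ two_pos).1 (hlam p hp.1 hp.2)
      omega
    exact ⟨p, hp, k, ⟨htk, hk_le⟩, hmem.imp_right fun h => ⟨_, h, T.reverse_reverse⟩⟩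
  · rintro ⟨p, -, k, -, hT | ⟨U, hU, rfl⟩⟩
    · exact ((UntwistedTree.mem_iSet_iff ht _).1 hT).1
    · exact UntwistedTree.reverse_mem_gen ((UntwistedTree.mem_iSet_iff ht _).1 hU).1
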